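/- Let $SO(3)$ be the group of real $3\times 3$ orthogonal matrices of determinant $1$, with the topology it inherits as a subspace of the space of all real $3\times 3$ matrices, and let $I$ be the identity matrix. Then the fundamental group $\pi_1(SO(3), I)$, that is, the group of homotopy classes (with endpoints fixed) of continuous paths $\omega:[0,1]\to SO(3)$ with $\omega(0)=\omega(1)=I$, is isomorphic to $\mathbb{Z}_2=\mathbb{Z}/2\mathbb{Z}$, the cyclic group of order $2$. -/

import Mathlib

/-!
The unit quaternions form a topological group `S³`, and conjugation by them gives a continuous
homomorphism `Quaternion.toSpecialOrthogonalGroup : S³ →* SO(3)`. It is onto with kernel `{1, -1}`,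
and, `S³` being compact, it is a quotient map. A quotient of a topological group by a discrete
subgroup is a covering, so `SO(3)` is covered by `S³` with deck group `{1, -1}`. Since `S³` is
simply connected, the fundamental group of `SO(3)` is (the opposite of) that deck group, which has
order two.

Two ingredients need proof.

* Simple connectedness of the unit sphere of a real inner product space of dimension at least three
  (`simplyConnectedSpace_sphere`). A loop in the sphere is uniformly close to a `C¹` loop of the
  ambient space, and radial projection of the segments joining the two loops is a homotopy in the
  sphere. The cone over a `C¹` curve is the image of a `C¹` map from the plane, so it cannot fill a
  space of dimension at least three; hence the projected loop misses a point of the sphere.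
  Stereographic projection from that point then contracts it.
* Surjectivity onto `SO(3)` (`Quaternion.toSpecialOrthogonalGroup_surjective`). If `1 + tr R > 0`, a
  quaternion inducing `R` can be read off from the entries of `R`. Otherwise `R` is first multiplied
  by one of the half-turns about the coordinate axes: together with `R` itself, the four resulting
  values of `1 + tr` add up to `4`, so one of them is positive.
-/

open Metric Set Topology unitInterval
open scoped Quaternion Matrix

/-! ### Simple connectedness of spheres -/

section Sphere

variable {E : Type*} [NormedAddCommGroup E] [InnerProductSpace ℝ E]

/-- A path is uniformly close to a `C¹` path with the same endpoints. -/
theorem Path.exists_contDiff_dist_lt [CompleteSpace E] {x y : E} (γ : Path x y) {ε : ℝ}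
    (hε : 0 < ε) :
    ∃ g : ℝ → E, ContDiff ℝ 1 g ∧ g 0 = x ∧ g 1 = y ∧ ∀ t : I, dist (γ t) (g t) < ε := by
  have hγ : UniformContinuous γ.extend :=
    (CompactSpace.uniformContinuous_of_continuous γ.continuous).comp
      (LipschitzWith.projIcc zero_le_one).uniformContinuous
  obtain ⟨h, hh, hd⟩ := hγ.exists_contDiff_dist_le (half_pos hε)
  have h0 : ‖x - h 0‖ < ε / 2 := by
    simpa [dist_eq_norm, norm_sub_rev] using hd 0
  have h1 : ‖y - h 1‖ < ε / 2 := by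
    simpa [dist_eq_norm, norm_sub_rev] using hd 1
  -- Adding the affine function that interpolates the errors of `h` at `0` and `1` restores the
  -- endpoints.
  refine ⟨fun t ↦ h t + ((1 - t) • (x - h 0) + t • (y - h 1)), ?_, by simp, by simp, fun t ↦ ?_⟩
  · have : ContDiff ℝ 1 h := hh.of_le (by exact_mod_cast le_top)
    fun_prop
  · have ht : ‖h t - γ t‖ < ε / 2 := by simpa [dist_eq_norm] using hd t
    have hc : ‖(1 - (t : ℝ)) • (x - h 0) + (t : ℝ) • (y - h 1)‖ < ε / 2 := by
      have := (convex_ball (0 : E) (ε / 2)) (mem_ball_zero_iff.2 h0) (mem_ball_zero_iff.2 h1)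
        (sub_nonneg.2 t.2.2) t.2.1 (by ring)
      exact mem_ball_zero_iff.1 this
    rw [dist_comm, dist_eq_norm, add_sub_right_comm]
    linarith [norm_add_le (h t - γ t) ((1 - (t : ℝ)) • (x - h 0) + (t : ℝ) • (y - h 1))]

/-- A path in the unit sphere is homotopic to the radial projection of any path in the ambient space
at pointwise distance less than `1` from it, because the segments joining them avoid the origin. -/
theorem exists_homotopic_eq_normalize {x y : sphere (0 : E) 1} (γ : Path x y) (g : C(I, E))
    (h0 : g 0 = x) (h1 : g 1 = y) (hg : ∀ t, dist (γ t : E) (g t) < 1) :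
    ∃ δ : Path x y, γ.Homotopic δ ∧ ∀ t, (δ t : E) = ‖g t‖⁻¹ • g t := by
  let F : I × I → E := fun p ↦ AffineMap.lineMap (γ p.2 : E) (g p.2) (p.1 : ℝ)
  have hF : Continuous F := by
    simp only [F, AffineMap.lineMap_apply_module]
    fun_prop
  have hF0 (p) : F p ≠ 0 := fun h ↦ by
    have hmem : F p ∈ ball (γ p.2 : E) 1 :=
      (convex_ball (γ p.2 : E) 1).segment_subset (mem_ball_self one_pos)
        (by rw [mem_ball']; exact hg p.2)
        (segment_eq_image_lineMap ℝ (γ p.2 : E) (g p.2) ▸ mem_image_of_mem _ p.1.2)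
    rw [h, mem_ball, dist_zero_left, norm_eq_of_mem_sphere] at hmem
    exact hmem.false
  have hN : Continuous fun p ↦ ‖F p‖⁻¹ • F p :=
    (hF.norm.inv₀ fun p ↦ norm_ne_zero_iff.2 (hF0 p)).smul hF
  have hS (p) : ‖F p‖⁻¹ • F p ∈ sphere (0 : E) 1 := by simp [norm_smul, hF0 p]
  let H : C(I × I, sphere (0 : E) 1) :=
    ⟨fun p ↦ ⟨‖F p‖⁻¹ • F p, hS p⟩, hN.subtype_mk hS⟩
  have hH (p) : (H p : E) = ‖F p‖⁻¹ • F p := rfl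
  let δ : Path x y :=
    { toFun := fun t ↦ H (1, t)
      continuous_toFun := by fun_prop
      source' := Subtype.ext <| by simp [hH, F, h0]
      target' := Subtype.ext <| by simp [hH, F, h1] }
  have hδ (t) : δ t = H (1, t) := rfl
  refine ⟨δ, ⟨⟨⟨H, fun t ↦ Subtype.ext ?_, fun t ↦ rfl⟩, ?_⟩⟩, fun t ↦ by simp [hδ, hH, F]⟩
  · simp [hH, F]
  · rintro t p (rfl | rfl) <;> refine Subtype.ext ?_ <;> simp [hH, F, h0, h1]

/-- In dimension at least three, some ray from the origin misses a given `C¹` curve: the cone over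
the curve is the image of a `C¹` map from `ℝ × ℝ`, so its complement is dense. -/
theorem exists_mem_sphere_forall_smul_ne [FiniteDimensional ℝ E] (hE : 2 < Module.finrank ℝ E)
    {g : ℝ → E} (hg : ContDiff ℝ 1 g) :
    ∃ v ∈ sphere (0 : E) 1, ∀ t r : ℝ, r • g t ≠ v := by
  have hd : Dense (range fun p : ℝ × ℝ ↦ p.2 • g p.1)ᶜ :=
    ContDiff.dense_compl_range_of_finrank_lt_finrank (by fun_prop) (by simpa using hE)
  have : Nontrivial E := Module.nontrivial_of_finrank_pos (R := ℝ) (by lia)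
  obtain ⟨w, hw⟩ := hd.nonempty
  have hw0 : w ≠ 0 := by
    rintro rfl
    exact hw ⟨(0, 0), by simp⟩
  refine ⟨‖w‖⁻¹ • w, by simp [norm_smul, hw0], fun t r h ↦ hw ⟨(t, ‖w‖ * r), ?_⟩⟩
  simp [mul_smul, h, hw0]

/-- A loop in the sphere that misses a point is null-homotopic, as the complement of the point is
homeomorphic to a vector space by stereographic projection. -/
theorem Path.homotopic_refl_of_forall_ne {x v : sphere (0 : E) 1} (γ : Path x x)
    (hγ : ∀ t, γ t ≠ v) : γ.Homotopic (Path.refl x) := by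
  let e := stereographic (norm_eq_of_mem_sphere v)
  have hs : e.symm.source = univ := by simp [e]
  have hc : Continuous e.symm := continuousOn_univ.1 (hs ▸ e.symm.continuousOn)
  have hm (t) : γ t ∈ e.source := by simpa [e] using hγ t
  have hx : e.symm (e x) = x := e.left_inv (γ.source ▸ hm 0)
  let δ : Path (e x) (e x) := γ.map' (e.continuousOn.mono (range_subset_iff.2 hm))
  have hδ : δ.Homotopic (Path.refl _) := SimplyConnectedSpace.paths_homotopic _ _
  have h : (δ.map hc).Homotopic ((Path.refl (e x)).map hc) := hδ.map ⟨e.symm, hc⟩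
  have h1 : (δ.map hc).cast hx.symm hx.symm = γ := by
    ext t
    exact congrArg _ (e.left_inv (hm t))
  have h2 : ((Path.refl (e x)).map hc).cast hx.symm hx.symm = Path.refl x := by
    ext t
    exact congrArg _ hx
  rw [← h1, ← h2]
  exact ⟨h.some.cast rfl rfl⟩

theorem simplyConnectedSpace_sphere [FiniteDimensional ℝ E] (hE : 2 < Module.finrank ℝ E) :
    SimplyConnectedSpace (sphere (0 : E) 1) := by
  rw [simply_connected_iff_loops_nullhomotopic]
  refine ⟨isPathConnected_iff_pathConnectedSpace.1 <| isPathConnected_sphere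
    (by rw [← Module.finrank_eq_rank]; exact_mod_cast (by lia : 1 < _)) 0 zero_le_one, fun x γ ↦ ?_⟩
  obtain ⟨g, hg, h0, h1, hd⟩ := (γ.map continuous_subtype_val).exists_contDiff_dist_lt one_pos
  obtain ⟨v, hv, hgv⟩ := exists_mem_sphere_forall_smul_ne hE hg
  obtain ⟨δ, hγδ, hδ⟩ := exists_homotopic_eq_normalize γ
    ⟨fun t : I ↦ g t, hg.continuous.comp continuous_subtype_val⟩ (by simpa using h0)
    (by simpa using h1) hd
  refine hγδ.trans (δ.homotopic_refl_of_forall_ne (v := ⟨v, hv⟩) fun t ht ↦ hgv t ‖g t‖⁻¹ ?_)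
  simpa [hδ] using congrArg Subtype.val ht

end Sphere

/-! ### The homomorphism from the unit quaternions to `SO(3)` -/

namespace Quaternion

/-- The matrix of `v ↦ q * v * star q` on the purely imaginary quaternions, in the basis `i`, `j`,
`k`. It is a rotation when `q` is a unit quaternion. -/
def rotationMatrix (q : ℍ[ℝ]) : Matrix (Fin 3) (Fin 3) ℝ :=
  !![q.re ^ 2 + q.imI ^ 2 - q.imJ ^ 2 - q.imK ^ 2, 2 * (q.imI * q.imJ - q.re * q.imK),
      2 * (q.imI * q.imK + q.re * q.imJ);
    2 * (q.imI * q.imJ + q.re * q.imK), q.re ^ 2 - q.imI ^ 2 + q.imJ ^ 2 - q.imK ^ 2,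
      2 * (q.imJ * q.imK - q.re * q.imI);
    2 * (q.imI * q.imK - q.re * q.imJ), 2 * (q.imJ * q.imK + q.re * q.imI),
      q.re ^ 2 - q.imI ^ 2 - q.imJ ^ 2 + q.imK ^ 2]

theorem rotationMatrix_one : rotationMatrix 1 = 1 := by
  ext i j
  fin_cases i <;> fin_cases j <;> simp [rotationMatrix]

theorem rotationMatrix_mul (p q : ℍ[ℝ]) :
    rotationMatrix (p * q) = rotationMatrix p * rotationMatrix q := by
  ext i j
  fin_cases i <;> fin_cases j <;> simp [rotationMatrix, Matrix.mul_apply, Fin.sum_univ_three] <;>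
    ring

theorem rotationMatrix_mul_transpose (q : ℍ[ℝ]) :
    rotationMatrix q * (rotationMatrix q)ᵀ = (normSq q ^ 2) • 1 := by
  ext i j
  fin_cases i <;> fin_cases j <;>
    simp [rotationMatrix, normSq_def', Matrix.mul_apply, Fin.sum_univ_three] <;> ring

theorem det_rotationMatrix (q : ℍ[ℝ]) : (rotationMatrix q).det = normSq q ^ 3 := by
  simp [rotationMatrix, normSq_def', Matrix.det_fin_three]
  ring

theorem continuous_rotationMatrix : Continuous rotationMatrix := by
  have := continuous_re
  have := continuous_imI
  have := continuous_imJ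
  have := continuous_imK
  refine continuous_matrix fun i j ↦ ?_
  fin_cases i <;> fin_cases j <;> simp [rotationMatrix] <;> fun_prop

theorem mem_unitSphere_iff_normSq_eq_one {q : ℍ[ℝ]} :
    q ∈ sphere (0 : ℍ[ℝ]) 1 ↔ normSq q = 1 := by
  rw [mem_sphere_zero_iff_norm, normSq_eq_norm_mul_self, ← sq,
    pow_eq_one_iff_of_nonneg (norm_nonneg _) two_ne_zero]

theorem normSq_coe_unitSphere (q : sphere (0 : ℍ[ℝ]) 1) : normSq (q : ℍ[ℝ]) = 1 :=
  mem_unitSphere_iff_normSq_eq_one.1 q.2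

/-- The homomorphism from the group of unit quaternions to `SO(3)` sending `q` to the rotation
`v ↦ q * v * star q` of the purely imaginary quaternions. -/
noncomputable def toSpecialOrthogonalGroup :
    sphere (0 : ℍ[ℝ]) 1 →* Matrix.specialOrthogonalGroup (Fin 3) ℝ where
  toFun q := ⟨rotationMatrix q, Matrix.mem_specialOrthogonalGroup_iff.2
    ⟨(Matrix.mem_orthogonalGroup_iff (Fin 3) ℝ).2 <| by
      rw [rotationMatrix_mul_transpose, normSq_coe_unitSphere, one_pow, one_smul],
    by rw [det_rotationMatrix, normSq_coe_unitSphere, one_pow]⟩⟩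
  map_one' := Subtype.ext rotationMatrix_one
  map_mul' p q := Subtype.ext (rotationMatrix_mul p q)

@[simp] theorem coe_toSpecialOrthogonalGroup (q : sphere (0 : ℍ[ℝ]) 1) :
    (toSpecialOrthogonalGroup q : Matrix (Fin 3) (Fin 3) ℝ) = rotationMatrix q := rfl

theorem continuous_toSpecialOrthogonalGroup : Continuous toSpecialOrthogonalGroup :=
  (continuous_rotationMatrix.comp continuous_subtype_val).subtype_mk _

theorem ker_toSpecialOrthogonalGroup :
    (toSpecialOrthogonalGroup.ker : Set (sphere (0 : ℍ[ℝ]) 1)) = {1, -1} := by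
  ext q
  have hq := normSq_coe_unitSphere q
  rw [normSq_def'] at hq
  simp only [SetLike.mem_coe, MonoidHom.mem_ker, mem_insert_iff, mem_singleton_iff]
  constructor
  · intro h
    replace h : rotationMatrix q = 1 := congrArg Subtype.val h
    have h00 := congrFun₂ h 0 0
    have h11 := congrFun₂ h 1 1
    have h22 := congrFun₂ h 2 2
    simp only [rotationMatrix, Matrix.of_apply, Matrix.cons_val, Matrix.one_apply_eq] at h00 h11 h22
    have hi : (q : ℍ[ℝ]).imI = 0 := by nlinarith
    have hj : (q : ℍ[ℝ]).imJ = 0 := by nlinarith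
    have hk : (q : ℍ[ℝ]).imK = 0 := by nlinarith
    have hr : (q : ℍ[ℝ]).re = 1 ∨ (q : ℍ[ℝ]).re = -1 := by
      rw [← sq_eq_one_iff]
      simpa [hi, hj, hk] using hq
    refine hr.imp (fun hr ↦ Subtype.ext ?_) (fun hr ↦ Subtype.ext ?_) <;>
      ext <;> simp [hi, hj, hk, hr]
  · rintro (rfl | rfl)
    · exact map_one _
    · refine Subtype.ext ?_
      ext i j
      fin_cases i <;> fin_cases j <;> simp [rotationMatrix]

end Quaternion

open Quaternion

/-! ### Surjectivity -/

/-- For `q = r + x i + y j + z k`, the matrix `rotationMatrix q` and `normSq q = 1` determine all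
products of two coordinates of `q`; in particular `4 r ^ 2 = 1 + tr`. When `1 + tr R` is positive,
this gives `r`, and dividing the products by `r` gives the other coordinates. -/
theorem Matrix.exists_rotationMatrix_eq_of_trace {R : Matrix (Fin 3) (Fin 3) ℝ}
    (hR : R ∈ specialOrthogonalGroup (Fin 3) ℝ) (ht : 0 < 1 + R.trace) :
    ∃ q ∈ sphere (0 : ℍ[ℝ]) 1, rotationMatrix q = R := by
  obtain ⟨ho, hdet⟩ := mem_specialOrthogonalGroup_iff.1 hR
  have hrow := (mem_orthogonalGroup_iff (Fin 3) ℝ).1 ho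
  have hcol := (mem_orthogonalGroup_iff' (Fin 3) ℝ).1 ho
  -- A rotation is its own cofactor matrix, so each entry is a `2 × 2` minor up to sign.
  have hadj : R.adjugate = Rᵀ := by
    calc R.adjugate = R.adjugate * (R * Rᵀ) := by rw [hrow, mul_one]
      _ = Rᵀ := by rw [← mul_assoc, adjugate_mul, hdet, one_smul, one_mul]
  simp only [← Matrix.ext_iff, Fin.forall_fin_succ, adjugate_fin_three] at hrow hcol hadj
  simp [Matrix.mul_apply, Fin.sum_univ_three, trace_fin_three] at hrow hcol hadj ht
  obtain ⟨s, hs0, hs2⟩ : ∃ s : ℝ, s ≠ 0 ∧ s ^ 2 = 1 + (R 0 0 + R 1 1 + R 2 2) :=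
    ⟨√(1 + (R 0 0 + R 1 1 + R 2 2)), (Real.sqrt_pos.2 ht).ne', Real.sq_sqrt ht.le⟩
  obtain ⟨⟨ro00, ro01, ro02⟩, ⟨-, ro11, ro12⟩, -, -, ro22⟩ := hrow
  obtain ⟨⟨co00, co01, co02⟩, ⟨-, co11, co12⟩, -, -, co22⟩ := hcol
  obtain ⟨⟨a00, a01, a02⟩, ⟨a10, a11, a12⟩, a20, a21, a22⟩ := hadj
  let q : ℍ[ℝ] :=
    ⟨s / 2, (R 2 1 - R 1 2) / (2 * s), (R 0 2 - R 2 0) / (2 * s), (R 1 0 - R 0 1) / (2 * s)⟩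
  -- The choice of `q` gives the products with `q.re` at once. The remaining products amount to the
  -- vanishing of `2 × 2` minors of the matrix of products, which follows from the orthonormality of
  -- rows and columns and the cofactor relations.
  have hrr : q.re * q.re = (1 + R 0 0 + R 1 1 + R 2 2) / 4 := by
    simp only [q]
    linear_combination hs2 / 4
  have hmul (x : ℝ) : s / 2 * (x / (2 * s)) = x / 4 := by
    field_simp
    ring
  have hri : q.re * q.imI = (R 2 1 - R 1 2) / 4 := hmul _
  have hrj : q.re * q.imJ = (R 0 2 - R 2 0) / 4 := hmul _
  have hrk : q.re * q.imK = (R 1 0 - R 0 1) / 4 := hmul _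
  have hdiv {x y z : ℝ} (h : (1 + (R 0 0 + R 1 1 + R 2 2)) * z = x * y) :
      x / (2 * s) * (y / (2 * s)) = z / 4 := by
    rw [div_mul_div_comm, ← h, ← hs2]
    field_simp
    ring
  have hii : q.imI * q.imI = (1 + R 0 0 - R 1 1 - R 2 2) / 4 :=
    hdiv (by linear_combination -ro11 - ro22 + co00 - 2 * a00)
  have hjj : q.imJ * q.imJ = (1 - R 0 0 + R 1 1 - R 2 2) / 4 :=
    hdiv (by linear_combination -ro00 - ro22 + co11 - 2 * a11)
  have hkk : q.imK * q.imK = (1 - R 0 0 - R 1 1 + R 2 2) / 4 :=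
    hdiv (by linear_combination -ro00 - ro11 + co22 - 2 * a22)
  have hij : q.imI * q.imJ = (R 0 1 + R 1 0) / 4 :=
    hdiv (by linear_combination -a01 - a10 + ro01 + co01)
  have hik : q.imI * q.imK = (R 0 2 + R 2 0) / 4 :=
    hdiv (by linear_combination -a02 - a20 + ro02 + co02)
  have hjk : q.imJ * q.imK = (R 1 2 + R 2 1) / 4 :=
    hdiv (by linear_combination -a12 - a21 + ro12 + co12)
  have hq : rotationMatrix q = R := by
    ext i j
    fin_cases i <;> fin_cases j <;> simp only [rotationMatrix] <;> simp <;> linarith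
  refine ⟨q, ?_, hq⟩
  have h3 : normSq q ^ 3 = 1 := by rw [← det_rotationMatrix, hq, hdet]
  exact mem_unitSphere_iff_normSq_eq_one.2 <|
    (pow_eq_one_iff_of_nonneg normSq_nonneg three_ne_zero).1 h3

theorem Quaternion.toSpecialOrthogonalGroup_surjective :
    Function.Surjective toSpecialOrthogonalGroup := by
  have key (R : Matrix.specialOrthogonalGroup (Fin 3) ℝ) (h : 0 < 1 + R.1.trace) :
      R ∈ toSpecialOrthogonalGroup.range := by
    obtain ⟨q, hq1, hq⟩ := Matrix.exists_rotationMatrix_eq_of_trace R.2 h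
    exact ⟨⟨q, hq1⟩, Subtype.ext hq⟩
  intro R
  have key' (a b c d : ℝ) (hq : a ^ 2 + b ^ 2 + c ^ 2 + d ^ 2 = 1)
      (h : 0 < 1 + (rotationMatrix ⟨a, b, c, d⟩ * R.1).trace) :
      R ∈ toSpecialOrthogonalGroup.range := by
    have hq1 : (⟨a, b, c, d⟩ : ℍ[ℝ]) ∈ sphere (0 : ℍ[ℝ]) 1 :=
      mem_unitSphere_iff_normSq_eq_one.2 <| (normSq_def' _).trans hq
    exact (Subgroup.mul_mem_cancel_left _ (MonoidHom.mem_range.2 ⟨⟨_, hq1⟩, rfl⟩)).1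
      (key (toSpecialOrthogonalGroup ⟨_, hq1⟩ * R) h)
  by_contra hR
  -- The four traces involved sum to zero, so the four inequalities below would add up to `4 ≤ 0`.
  replace key' a b c d hq := not_lt.1 (mt (key' a b c d hq) hR)
  have h1 := key' 1 0 0 0 (by norm_num)
  have hi := key' 0 1 0 0 (by norm_num)
  have hj := key' 0 0 1 0 (by norm_num)
  have hk := key' 0 0 0 1 (by norm_num)
  simp only [Matrix.trace_fin_three, Matrix.mul_apply, Fin.sum_univ_three] at h1 hi hj hk
  simp [rotationMatrix] at h1 hi hj hk
  linarith

/-! ### The covering and the fundamental group -/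

theorem Quaternion.isQuotientCoveringMap_toSpecialOrthogonalGroup :
    IsQuotientCoveringMap toSpecialOrthogonalGroup toSpecialOrthogonalGroup.ker := by
  refine Topology.IsQuotientMap.isQuotientCoveringMap_of_isDiscrete_ker_monoidHom ?_ ?_
  · exact .of_surjective_continuous toSpecialOrthogonalGroup_surjective
      continuous_toSpecialOrthogonalGroup
  · rw [ker_toSpecialOrthogonalGroup]
    exact (Set.toFinite _).isDiscrete

theorem Quaternion.card_ker_toSpecialOrthogonalGroup :
    Nat.card toSpecialOrthogonalGroup.ker = 2 := by
  have h : (1 : sphere (0 : ℍ[ℝ]) 1) ≠ -1 := fun h ↦ by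
    have := congrArg (fun q : sphere (0 : ℍ[ℝ]) 1 ↦ (q : ℍ[ℝ]).re) h
    norm_num at this
  rw [← SetLike.coe_sort_coe, ker_toSpecialOrthogonalGroup, Nat.card_coe_set_eq, Set.ncard_pair h]

theorem mainTheorem1 :
    Nonempty (FundamentalGroup (Matrix.specialOrthogonalGroup (Fin 3) ℝ) 1 ≃*
      Multiplicative (ZMod 2)) := by
  have : SimplyConnectedSpace (sphere (0 : ℍ[ℝ]) 1) :=
    simplyConnectedSpace_sphere (by rw [Quaternion.finrank_eq_four]; norm_num)
  let e := isQuotientCoveringMap_toSpecialOrthogonalGroup.fundamentalGroupEquiv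
    ⟨1, map_one toSpecialOrthogonalGroup⟩
  exact ⟨e.trans (mulEquivOfPrimeCardEq (p := 2)
    ((Nat.card_congr MulOpposite.opEquiv.symm).trans card_ker_toSpecialOrthogonalGroup)
    (by simp))⟩
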